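/- Let $q\ge 1$ and let $A=(a_1,\dots,a_q)$, $B=(b_1,\dots,b_q)$ be real vectors such that $B$ is weakly supermajorized by $A$, that is, $0<a_1\le a_2\le\dots\le a_q$, $0<b_1\le b_2\le\dots\le b_q$ and $$\sum_{i=1}^k a_i\le\sum_{i=1}^k b_i\qquad (k=1,\dots,q).$$ Assume that $A\neq B$ and that $a_1>1$, $b_1>1$, and let $0<\sigma\le 1$. Then the series $$\sum_{n=0}^\infty\frac{(\sigma)_n(a_1)_n\cdots(a_q)_n}{(b_1)_n\cdots(b_q)_n\,n!}\,z^n,$$ where $(a)_0=1$ and $(a)_n=a(a+1)\cdots(a+n-1)$ for $n\ge1$, converges for $|z|<1$ and its sum extends (uniquely) to a holomorphic function ${}_{q+1}F_q(\sigma,A;B;z)$ on $\mathbb{C}\setminus[1,\infty)$; and for every $x>0$ the value ${}_{q+1}F_q(\sigma,A;B;-x)$ is real and $${}_{q+1}F_q(\sigma,A;B;-x)<\frac{1}{\Bigl(1+x\prod_{i=1}^{q}\frac{a_i-1}{b_i-1}\Bigr)^{\sigma}}.$$ -/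

import Mathlib

/-- The `n`-th term of the series of `_{q+1}F_q(σ, A; B; z)`, that is
`(σ)_n (a_1)_n ⋯ (a_q)_n / ((b_1)_n ⋯ (b_q)_n n!) z^n`, where `(a)_n` is the rising factorial. -/
noncomputable def hypTerm {q : ℕ} (σ : ℂ) (A B : Fin q → ℂ) (z : ℂ) (n : ℕ) : ℂ :=
  ((ascPochhammer ℂ n).eval σ * ∏ i, (ascPochhammer ℂ n).eval (A i)) /
    ((∏ i, (ascPochhammer ℂ n).eval (B i)) * (n.factorial : ℂ)) * z ^ n

/-- The complex plane cut along the ray `[1, ∞)`. -/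
def cutPlane : Set ℂ := {z | z.im = 0 → z.re < 1}

/-- `F` is holomorphic on the plane cut along `[1, ∞)`, and on the unit disk it is the sum of the
(convergent) series of `_{q+1}F_q(σ, A; B; ·)`. -/
structure IsHypContinuation {q : ℕ} (σ : ℂ) (A B : Fin q → ℂ) (F : ℂ → ℂ) : Prop where
  analytic : AnalyticOnNhd ℂ F cutPlane
  hasSum : ∀ z : ℂ, ‖z‖ < 1 → HasSum (hypTerm σ A B z) (F z)

lemma cutPlane_eq : cutPlane = (fun z : ℂ => 1 - z) '' Complex.slitPlane := by
  ext z
  simp only [cutPlane, Set.mem_ofPred_eq, Set.mem_image]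
  constructor
  · intro h
    refine ⟨1 - z, ?_, by ring⟩
    rw [Complex.mem_slitPlane_iff]
    by_cases hz : z.im = 0
    · left
      have := h hz
      simp only [Complex.sub_re, Complex.one_re]
      linarith
    · right
      simpa using hz
  · rintro ⟨w, hw, rfl⟩ him
    rw [Complex.mem_slitPlane_iff] at hw
    have h0 : w.im = 0 := by simpa using him
    rcases hw with hw | hw
    · simp only [Complex.sub_re, Complex.one_re]
      linarith
    · exact absurd h0 hw

/-- The analytic continuation is unique: two of them agree on the cut plane. -/
lemma IsHypContinuation.eqOn {q : ℕ} {σ : ℂ} {A B : Fin q → ℂ} {F G : ℂ → ℂ}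
    (hF : IsHypContinuation σ A B F) (hG : IsHypContinuation σ A B G) :
    Set.EqOn F G cutPlane := by
  have hconn : IsPreconnected cutPlane := by
    rw [cutPlane_eq]
    have h1 : IsPreconnected Complex.slitPlane :=
      (Complex.starConvex_one_slitPlane.isPathConnected
        Complex.one_mem_slitPlane).isConnected.isPreconnected
    exact h1.image _ (by fun_prop)
  refine hF.analytic.eqOn_of_preconnected_of_eventuallyEq hG.analytic hconn
    (z₀ := 0) (by simp [cutPlane]) ?_
  filter_upwards [Metric.ball_mem_nhds (0 : ℂ) one_pos] with z hz
  have hz' : ‖z‖ < 1 := by simpa using hz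
  exact (hF.hasSum z hz').unique (hG.hasSum z hz')

open Classical in
/-- The generalized hypergeometric function `_{q+1}F_q(σ, A; B; ·)`: the analytic continuation of
its series to the plane cut along `[1, ∞)`. Its values on the cut, and its values when there is no
such continuation, carry no meaning. -/
noncomputable def genHyp {q : ℕ} (σ : ℂ) (A B : Fin q → ℂ) : ℂ → ℂ :=
  if h : ∃ F, IsHypContinuation σ A B F then h.choose else 0

/-- Every analytic continuation of the series agrees with `genHyp` on the cut plane. -/
lemma IsHypContinuation.genHyp_eqOn {q : ℕ} {σ : ℂ} {A B : Fin q → ℂ} {F : ℂ → ℂ}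
    (hF : IsHypContinuation σ A B F) : Set.EqOn (genHyp σ A B) F cutPlane := by
  have h : ∃ F, IsHypContinuation σ A B F := ⟨F, hF⟩
  rw [genHyp, dif_pos h]
  exact h.choose_spec.eqOn hF

/-- `B` is weakly supermajorized by `A`: both are positive and nondecreasing, and
`∑_{i ≤ k} a_i ≤ ∑_{i ≤ k} b_i` for every `k`. -/
structure WeaklySupermajorizedBy {q : ℕ} (B A : Fin q → ℝ) : Prop where
  pos_A : ∀ i, 0 < A i
  mono_A : Monotone A
  pos_B : ∀ i, 0 < B i
  mono_B : Monotone B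
  sum_le : ∀ k : Fin q, ∑ i ∈ Finset.Iic k, A i ≤ ∑ i ∈ Finset.Iic k, B i

/-!
Write `m n = ∏ i, (a_i - 1)_n / (b_i - 1)_n`. This is the infinite product over `k` of the sequences
`∏ i, α_i / (α_i + n) * ((β_i + n) / β_i)` with `α_i = a_i - 1 + k` and `β_i = b_i - 1 + k`. Each of
them is the moment sequence of a probability measure on `[0, 1]`: weak supermajorization connects
`A` to `B` by Robin Hood transfers followed by increases of coordinates, and one such move
multiplies the sequence by a convex combination of `1` and of products of sequences `a / (a + n)`.
Moment sequences of probability measures are closed under products (multiplicative convolution) and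
limits (compactness), so `m n = ∫ t ^ n dν`. Since `m (n + 1) / m 1 = ∏ i, (a_i)_n / (b_i)_n`, the
hypergeometric function is `z ↦ (1 / m 1) * ∫ t (1 - z t) ^ (-σ) dν`, and the inequality is the one
of Jensen for the strictly concave function `t (1 + x t) ^ (-σ)`. It is strict because `A ≠ B`
forces `m 1 ^ 2 < m 2`, that is, `ν` is not a Dirac mass.
-/

open MeasureTheory Filter Topology

/-! ### Weak supermajorization -/

section Supermajorization

variable {ι : Type*} [LinearOrder ι]

/-- The Robin Hood transfer of majorization theory: the amount `δ` is moved from the coordinate `k`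
of `A` to the coordinate `j`. -/
def transfer (A : ι → ℝ) (j k : ι) (δ : ℝ) : ι → ℝ :=
  A + Pi.single j δ - Pi.single k δ

lemma transfer_apply_left (A : ι → ℝ) {j k : ι} (hjk : j ≠ k) (δ : ℝ) :
    transfer A j k δ j = A j + δ := by
  simp [transfer, hjk]

lemma transfer_apply_right (A : ι → ℝ) {j k : ι} (hjk : j ≠ k) (δ : ℝ) :
    transfer A j k δ k = A k - δ := by
  simp [transfer, hjk.symm]

lemma transfer_apply_of_ne (A : ι → ℝ) {i j k : ι} (hij : i ≠ j) (hik : i ≠ k) (δ : ℝ) :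
    transfer A j k δ i = A i := by
  simp [transfer, hij, hik]

lemma transfer_pos {A : ι → ℝ} (hA : ∀ i, 0 < A i) {j k : ι} {δ : ℝ} (hδ : 0 < δ)
    (hδA : A j + δ ≤ A k - δ) (i : ι) : 0 < transfer A j k δ i := by
  have hjk : j ≠ k := by rintro rfl; linarith
  have hj := hA j
  rcases eq_or_ne i j with rfl | hij
  · rw [transfer_apply_left A hjk]; linarith
  rcases eq_or_ne i k with rfl | hik
  · rw [transfer_apply_right A hjk]; linarith
  · rw [transfer_apply_of_ne A hij hik]; exact hA i

lemma card_filter_transfer_ne_lt [Fintype ι] {A B : ι → ℝ} {j k : ι} (hj : A j ≠ B j)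
    (hk : A k ≠ B k) {δ : ℝ} (hδ : transfer A j k δ j = B j ∨ transfer A j k δ k = B k) :
    (Finset.univ.filter fun i => transfer A j k δ i ≠ B i).card <
      (Finset.univ.filter fun i => A i ≠ B i).card := by
  have hsub : (Finset.univ.filter fun i => transfer A j k δ i ≠ B i) ⊆
      Finset.univ.filter fun i => A i ≠ B i := by
    intro i hi
    simp only [Finset.mem_filter_univ] at hi ⊢
    rcases eq_or_ne i j with rfl | hij
    · exact hj
    rcases eq_or_ne i k with rfl | hik
    · exact hk
    rwa [transfer_apply_of_ne A hij hik] at hi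
  rcases hδ with h | h
  · exact Finset.card_lt_card (Finset.ssubset_iff_of_subset hsub |>.mpr ⟨j, by simpa, by simpa⟩)
  · exact Finset.card_lt_card (Finset.ssubset_iff_of_subset hsub |>.mpr ⟨k, by simpa, by simpa⟩)

variable [LocallyFiniteOrderBot ι] {A B : ι → ℝ}

lemma forall_lt_of_sum_Iic_le (hB : Monotone B)
    (hsum : ∀ k, ∑ i ∈ Finset.Iic k, A i ≤ ∑ i ∈ Finset.Iic k, B i) {c : ℝ} (hA : ∀ i, c < A i)
    (i : ι) : c < B i := by
  obtain ⟨j, hj, hAB⟩ := Finset.exists_le_of_sum_le ⟨i, Finset.mem_Iic.mpr le_rfl⟩ (hsum i)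
  exact (hA j).trans_le (hAB.trans (hB (Finset.mem_Iic.mp hj)))

lemma exists_lt_of_sum_Iic_le {k : ι}
    (hsum : ∑ i ∈ Finset.Iic k, A i ≤ ∑ i ∈ Finset.Iic k, B i) (hk : B k < A k) :
    ∃ j < k, A j < B j := by
  by_contra! hle
  refine hsum.not_gt (Finset.sum_lt_sum (fun i hi => ?_) ⟨k, Finset.mem_Iic.mpr le_rfl, hk⟩)
  rcases (Finset.mem_Iic.mp hi).lt_or_eq with hik | rfl
  · exact hle i hik
  · exact hk.le

lemma sum_Iic_transfer_le {j k : ι} (hjk : j < k) {δ : ℝ} (hδ : A j + δ ≤ B j)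
    (hlt : ∀ i < k, A i ≤ B i)
    (hsum : ∀ m, ∑ i ∈ Finset.Iic m, A i ≤ ∑ i ∈ Finset.Iic m, B i) (m : ι) :
    ∑ i ∈ Finset.Iic m, transfer A j k δ i ≤ ∑ i ∈ Finset.Iic m, B i := by
  rcases le_or_gt k m with hkm | hmk
  · simpa [transfer, Finset.sum_add_distrib, Finset.sum_pi_single, hkm, hjk.le.trans hkm]
      using hsum m
  · refine Finset.sum_le_sum fun i hi => ?_
    have hik : i < k := (Finset.mem_Iic.mp hi).trans_lt hmk
    rcases eq_or_ne i j with rfl | hij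
    · rwa [transfer_apply_left A hjk.ne]
    · rw [transfer_apply_of_ne A hij hik.ne]
      exact hlt i hik

/-- A coordinate exceeding `B` pays an earlier one that falls short of it, up to the first moment
when one of the two agrees with `B`. -/
lemma exists_transfer_of_not_le [Fintype ι] (hB : Monotone B)
    (hsum : ∀ k, ∑ i ∈ Finset.Iic k, A i ≤ ∑ i ∈ Finset.Iic k, B i) (hle : ¬ A ≤ B) :
    ∃ j k δ, 0 < δ ∧ A j + δ ≤ A k - δ ∧
      (∀ m, ∑ i ∈ Finset.Iic m, transfer A j k δ i ≤ ∑ i ∈ Finset.Iic m, B i) ∧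
      (Finset.univ.filter fun i => transfer A j k δ i ≠ B i).card <
        (Finset.univ.filter fun i => A i ≠ B i).card := by
  obtain ⟨k, hkmin⟩ := exists_minimal_of_wellFoundedLT (fun k => B k < A k) (by
    simpa [Pi.le_def] using hle)
  have hk : B k < A k := hkmin.prop
  obtain ⟨j, hjk, hj⟩ := exists_lt_of_sum_Iic_le (hsum k) hk
  have hBjk : B j ≤ B k := hB hjk.le
  have hδj : min (B j - A j) (A k - B k) ≤ B j - A j := min_le_left _ _
  have hδk : min (B j - A j) (A k - B k) ≤ A k - B k := min_le_right _ _
  refine ⟨j, k, min (B j - A j) (A k - B k), lt_min (by linarith) (by linarith), by linarith,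
    sum_Iic_transfer_le hjk (by linarith) (fun i hi => not_lt.mp (hkmin.not_prop_of_lt hi)) hsum,
    card_filter_transfer_ne_lt hj.ne hk.ne' ?_⟩
  rw [transfer_apply_left A hjk.ne, transfer_apply_right A hjk.ne]
  rcases min_choice (B j - A j) (A k - B k) with h | h <;> rw [h]
  · exact .inl (by ring)
  · exact .inr (by ring)

theorem weakSupermajorization_induction [Finite ι] {P : (ι → ℝ) → Prop} (hB : Monotone B)
    (of_le : ∀ A ≤ B, P A)
    (of_transfer : ∀ A j k δ, 0 < δ → A j + δ ≤ A k - δ → P (transfer A j k δ) → P A)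
    (hsum : ∀ k, ∑ i ∈ Finset.Iic k, A i ≤ ∑ i ∈ Finset.Iic k, B i) : P A := by
  cases nonempty_fintype ι
  induction hd : (Finset.univ.filter fun i => A i ≠ B i).card using Nat.strong_induction_on
    generalizing A with
  | _ d ih =>
  by_cases hle : A ≤ B
  · exact of_le A hle
  obtain ⟨j, k, δ, hδ, hδA, hsum', hcard⟩ := exists_transfer_of_not_le hB hsum hle
  exact of_transfer A j k δ hδ hδA (ih _ (hd ▸ hcard) hsum' rfl)

end Supermajorization

/-! ### Hausdorff moment sequences -/

section HausdorffMoments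

lemma integrable_of_continuous {X E : Type*} [TopologicalSpace X] [CompactSpace X]
    [MeasurableSpace X] [OpensMeasurableSpace X] [NormedAddCommGroup E] (μ : Measure X)
    [IsFiniteMeasure μ] {f : X → E} (hf : Continuous f) : Integrable f μ :=
  hf.integrable_of_hasCompactSupport (HasCompactSupport.of_compactSpace f)

/-- The moments of a measure on `[0, 1]`. -/
noncomputable def momentSeq (μ : Measure unitInterval) (n : ℕ) : ℝ :=
  ∫ t, (t : ℝ) ^ n ∂μ

lemma momentSeq_mconv (μ ν : Measure unitInterval) [IsFiniteMeasure μ] [IsFiniteMeasure ν] :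
    momentSeq (μ ∗ₘ ν) = momentSeq μ * momentSeq ν := by
  funext n
  rw [momentSeq, integral_mconv (integrable_of_continuous _ (by fun_prop))]
  simp only [Set.Icc.coe_mul, mul_pow, integral_const_mul, integral_mul_const, Pi.mul_apply,
    momentSeq]

lemma momentSeq_add_smul (μ ν : Measure unitInterval) [IsFiniteMeasure μ] [IsFiniteMeasure ν]
    {a b : ℝ} (ha : 0 ≤ a) (hb : 0 ≤ b) :
    momentSeq (ENNReal.ofReal a • μ + ENNReal.ofReal b • ν) =
      a • momentSeq μ + b • momentSeq ν := by
  funext n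
  have hint (ρ : Measure unitInterval) [IsFiniteMeasure ρ] :
      Integrable (fun t : unitInterval => (t : ℝ) ^ n) ρ :=
    integrable_of_continuous ρ (by fun_prop)
  rw [momentSeq, integral_add_measure ((hint μ).smul_measure ENNReal.ofReal_ne_top)
    ((hint ν).smul_measure ENNReal.ofReal_ne_top), integral_smul_measure, integral_smul_measure,
    ENNReal.toReal_ofReal ha, ENNReal.toReal_ofReal hb]
  rfl

/-- The moment sequences of the probability measures on `[0, 1]`, which form a monoid because
multiplicative convolution of measures multiplies their moments. -/
noncomputable def hausdorffMoments : Submonoid (ℕ → ℝ) where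
  carrier := Set.range fun ν : ProbabilityMeasure unitInterval => momentSeq ν
  one_mem' := ⟨⟨Measure.dirac 1, inferInstance⟩, by ext n; simp [momentSeq]⟩
  mul_mem' := by
    rintro _ _ ⟨μ, rfl⟩ ⟨ν, rfl⟩
    exact ⟨⟨(μ : Measure unitInterval) ∗ₘ ν, inferInstance⟩, momentSeq_mconv μ ν⟩

lemma exists_momentSeq_eq {m : ℕ → ℝ} (hm : m ∈ hausdorffMoments) :
    ∃ ν : Measure unitInterval, IsProbabilityMeasure ν ∧ momentSeq ν = m := by
  obtain ⟨ν, hν⟩ := hm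
  exact ⟨ν, inferInstance, hν⟩

lemma momentSeq_mem_hausdorffMoments (μ : Measure unitInterval) [IsProbabilityMeasure μ] :
    momentSeq μ ∈ hausdorffMoments :=
  ⟨⟨μ, inferInstance⟩, rfl⟩

lemma convex_hausdorffMoments : Convex ℝ (hausdorffMoments : Set (ℕ → ℝ)) := by
  rintro _ ⟨μ, rfl⟩ _ ⟨ν, rfl⟩ a b ha hb hab
  refine ⟨⟨ENNReal.ofReal a • (μ : Measure unitInterval) + ENNReal.ofReal b • ν, ⟨?_⟩⟩,
    momentSeq_add_smul μ ν ha hb⟩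
  simp [← ENNReal.ofReal_add ha hb, hab]

/-- The space of probability measures on `[0, 1]` is compact for weak convergence. -/
lemma isClosed_hausdorffMoments : IsClosed (hausdorffMoments : Set (ℕ → ℝ)) :=
  (isCompact_range (continuous_pi fun n =>
    ProbabilityMeasure.continuous_integral_boundedContinuousFunction
      (BoundedContinuousFunction.mkOfCompact
        ⟨fun t : unitInterval => (t : ℝ) ^ n, by fun_prop⟩))).isClosed

/-- The measure is the law of `U ^ (1 / a)` for `U` uniform on `[0, 1]`. -/
lemma div_add_mem_hausdorffMoments {a : ℝ} (ha : 0 < a) :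
    (fun n : ℕ => a / (a + n)) ∈ hausdorffMoments := by
  set φ : unitInterval → unitInterval := fun t =>
    ⟨(t : ℝ) ^ (1 / a), Real.rpow_nonneg t.2.1 _, Real.rpow_le_one t.2.1 t.2.2 (by positivity)⟩
  have hφ : Continuous φ :=
    (continuous_subtype_val.rpow_const fun _ => .inr (by positivity)).subtype_mk _
  have := Measure.isProbabilityMeasure_map (μ := volume) hφ.aemeasurable
  convert momentSeq_mem_hausdorffMoments (volume.map φ) using 1
  funext n
  have hpow (t : unitInterval) : (φ t : ℝ) ^ n = (t : ℝ) ^ (n / a) := by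
    rw [← Real.rpow_mul_natCast t.2.1, one_div_mul_eq_div]
  have hn : (0 : ℝ) ≤ n / a := by positivity
  rw [momentSeq, integral_map hφ.aemeasurable (Continuous.aestronglyMeasurable (by fun_prop))]
  simp only [hpow]
  rw [unitInterval.volume_def, integral_subtype_comap (μ := (volume : Measure ℝ))
    measurableSet_Icc (fun t : ℝ => t ^ (n / a : ℝ)), integral_Icc_eq_integral_Ioc,
    ← intervalIntegral.integral_of_le zero_le_one, integral_rpow (.inl (by linarith)),
    Real.zero_rpow (by positivity), Real.one_rpow]
  field_simp
  ring

end HausdorffMoments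

/-! ### Ratios of rising factorials -/

section AffineRatio

variable {ι : Type*} [Fintype ι]

/-- The rational function `∏ i, (B i + n) / (A i + n)` of `n`, normalized to be `1` at `n = 0`. It
is the quotient of the ratio `∏ i, (A i)_n / (B i)_n` of rising factorials by the same ratio with
all parameters increased by `1`. -/
noncomputable def affineRatio (A B : ι → ℝ) (n : ℕ) : ℝ :=
  ∏ i, A i * (B i + n) / ((A i + n) * B i)

lemma affineRatio_pos {A B : ι → ℝ} (hA : ∀ i, 0 < A i) (hB : ∀ i, 0 < B i) (n : ℕ) :
    0 < affineRatio A B n :=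
  Finset.prod_pos fun i _ => by
    have := hA i
    have := hB i
    positivity

lemma affineRatio_mul_affineRatio (A B : ι → ℝ) {C : ι → ℝ} (hC : ∀ i, 0 < C i) :
    affineRatio A C * affineRatio C B = affineRatio A B := by
  funext n
  simp only [affineRatio, Pi.mul_apply, ← Finset.prod_mul_distrib]
  refine Finset.prod_congr rfl fun i _ => ?_
  have := hC i
  have : 0 < C i + n := by positivity
  field_simp

lemma affineRatio_transfer [LinearOrder ι] {A : ι → ℝ} (hA : ∀ i, 0 < A i) {j k : ι}
    (hjk : j ≠ k) (δ : ℝ) (n : ℕ) :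
    affineRatio A (transfer A j k δ) n =
      A j * (A j + δ + n) / ((A j + n) * (A j + δ)) *
        (A k * (A k - δ + n) / ((A k + n) * (A k - δ))) := by
  rw [affineRatio, Finset.prod_eq_mul j k hjk _ (by simp) (by simp), transfer_apply_left A hjk,
    transfer_apply_right A hjk]
  rintro i - ⟨hij, hik⟩
  rw [transfer_apply_of_ne A hij hik]
  have := hA i
  field_simp

lemma affineRatio_mem_hausdorffMoments_of_le {A B : ι → ℝ} (hA : ∀ i, 0 < A i) (hAB : A ≤ B) :
    affineRatio A B ∈ hausdorffMoments := by
  have hfactor (i : ι) :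
      (fun n : ℕ => A i * (B i + n) / ((A i + n) * B i)) ∈ hausdorffMoments := by
    have hAi := hA i
    have hBi : 0 < B i := hAi.trans_le (hAB i)
    rw [← SetLike.mem_coe]
    convert convex_hausdorffMoments (one_mem _) (div_add_mem_hausdorffMoments hAi)
      (a := A i / B i) (b := (B i - A i) / B i) (by positivity)
      (div_nonneg (sub_nonneg.mpr (hAB i)) hBi.le) (by field_simp; ring) using 1
    funext n
    simp only [Pi.add_apply, Pi.smul_apply, Pi.one_apply, smul_eq_mul]
    field_simp
    ring
  convert prod_mem fun i (_ : i ∈ Finset.univ) => hfactor i using 1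
  funext n
  simp [affineRatio]

lemma affineRatio_transfer_mem_hausdorffMoments [LinearOrder ι] {A : ι → ℝ} (hA : ∀ i, 0 < A i)
    {j k : ι} {δ : ℝ} (hδ : 0 < δ) (hδA : A j + δ ≤ A k - δ) :
    affineRatio A (transfer A j k δ) ∈ hausdorffMoments := by
  have hjk : j ≠ k := by rintro rfl; linarith
  have hj := hA j
  have hk := hA k
  have hkδ : 0 < A k - δ := by linarith
  -- `(a + δ + n) (b - δ + n) = (a + n) (b + n) + δ (b - a - δ)` gives the weights.
  rw [← SetLike.mem_coe]
  convert convex_hausdorffMoments (one_mem _)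
    (mul_mem (div_add_mem_hausdorffMoments hj) (div_add_mem_hausdorffMoments hk))
    (a := A j * A k / ((A j + δ) * (A k - δ)))
    (b := δ * (A k - A j - δ) / ((A j + δ) * (A k - δ))) (by positivity)
    (div_nonneg (mul_nonneg hδ.le (by linarith)) (by positivity)) (by field_simp; ring) using 1
  funext n
  rw [affineRatio_transfer hA hjk]
  simp only [Pi.add_apply, Pi.smul_apply, Pi.one_apply, Pi.mul_apply, smul_eq_mul]
  field_simp
  ring

lemma affineRatio_one_lt_one_of_lt {A B : ι → ℝ} (hA : ∀ i, 0 < A i) (hAB : A < B) :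
    affineRatio A B 1 < 1 := by
  obtain ⟨hle, i₀, hi₀⟩ := Pi.lt_def.mp hAB
  have hB (i : ι) : 0 < B i := (hA i).trans_le (hle i)
  refine (Finset.prod_lt_prod (g := 1) (fun i _ => ?_) (fun i _ => ?_)
    ⟨i₀, Finset.mem_univ _, ?_⟩).trans_eq Finset.prod_const_one
  · have := hA i
    have := hB i
    positivity
  · have := hA i
    have := hB i
    rw [Pi.one_apply, div_le_one (by positivity)]
    push_cast
    nlinarith [hle i]
  · have := hA i₀
    have := hB i₀
    rw [Pi.one_apply, div_lt_one (by positivity)]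
    push_cast
    nlinarith [hi₀]

lemma affineRatio_transfer_one_lt_one [LinearOrder ι] {A : ι → ℝ} (hA : ∀ i, 0 < A i)
    {j k : ι} {δ : ℝ} (hδ : 0 < δ) (hδA : A j + δ ≤ A k - δ) :
    affineRatio A (transfer A j k δ) 1 < 1 := by
  have hjk : j ≠ k := by rintro rfl; linarith
  have hj := hA j
  have hk := hA k
  have hkδ : 0 < A k - δ := by linarith
  have hprod : A j * A k < (A j + δ) * (A k - δ) := by nlinarith
  rw [affineRatio_transfer hA hjk, div_mul_div_comm, div_lt_one (by positivity)]
  push_cast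
  nlinarith

variable [LinearOrder ι] [LocallyFiniteOrderBot ι] {A B : ι → ℝ}

theorem affineRatio_mem_hausdorffMoments (hA : ∀ i, 0 < A i) (hB : Monotone B)
    (hsum : ∀ k, ∑ i ∈ Finset.Iic k, A i ≤ ∑ i ∈ Finset.Iic k, B i) :
    affineRatio A B ∈ hausdorffMoments := by
  revert hA
  refine weakSupermajorization_induction hB
    (fun A hAB hA => affineRatio_mem_hausdorffMoments_of_le hA hAB) ?_ hsum
  intro A j k δ hδ hδA ih hA
  have hC := transfer_pos hA hδ hδA
  rw [← affineRatio_mul_affineRatio A B hC]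
  exact mul_mem (affineRatio_transfer_mem_hausdorffMoments hA hδ hδA) (ih hC)

theorem affineRatio_one_lt_one (hA : ∀ i, 0 < A i) (hB : Monotone B)
    (hsum : ∀ k, ∑ i ∈ Finset.Iic k, A i ≤ ∑ i ∈ Finset.Iic k, B i) (hne : A ≠ B) :
    affineRatio A B 1 < 1 := by
  revert hA hne
  refine weakSupermajorization_induction hB
    (fun A hAB hA hne => affineRatio_one_lt_one_of_lt hA (lt_of_le_of_ne hAB hne)) ?_ hsum
  intro A j k δ hδ hδA ih hA _
  have hC := transfer_pos hA hδ hδA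
  have hAC := affineRatio_transfer_one_lt_one hA hδ hδA
  rcases eq_or_ne (transfer A j k δ) B with hCB | hCB
  · rwa [← hCB]
  rw [← affineRatio_mul_affineRatio A B hC, Pi.mul_apply]
  exact mul_lt_one_of_nonneg_of_lt_one_left (affineRatio_pos hA hC 1).le hAC (ih hC hCB).le

end AffineRatio

section PochRatio

variable {ι : Type*} [Fintype ι]

/-- The ratio `∏ i, (A i)_n / (B i)_n` of products of rising factorials, which is the coefficient
of the hypergeometric series without its factor `(σ)_n / n!`. -/
noncomputable def pochRatio (A B : ι → ℝ) (n : ℕ) : ℝ :=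
  ∏ i, (ascPochhammer ℝ n).eval (A i) / (ascPochhammer ℝ n).eval (B i)

lemma pochRatio_pos {A B : ι → ℝ} (hA : ∀ i, 0 < A i) (hB : ∀ i, 0 < B i) (n : ℕ) :
    0 < pochRatio A B n :=
  Finset.prod_pos fun i _ => div_pos (ascPochhammer_pos n _ (hA i)) (ascPochhammer_pos n _ (hB i))

lemma pochRatio_one (A B : ι → ℝ) : pochRatio A B 1 = ∏ i, A i / B i := by
  simp [pochRatio]

lemma pochRatio_succ (A B : ι → ℝ) (n : ℕ) :
    pochRatio A B (n + 1) = pochRatio A B 1 * pochRatio (A + 1) (B + 1) n := by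
  simp [pochRatio, ascPochhammer_succ_left, mul_div_mul_comm, Finset.prod_mul_distrib]

lemma ascPochhammer_eval_mul_add {R : Type*} [CommSemiring R] (a : R) (n : ℕ) :
    (ascPochhammer R n).eval a * (a + n) = a * (ascPochhammer R n).eval (a + 1) := by
  simp [← ascPochhammer_succ_eval, ascPochhammer_succ_left]

lemma pochRatio_eq_affineRatio_mul {A B : ι → ℝ} (hA : ∀ i, 0 < A i) (hB : ∀ i, 0 < B i)
    (n : ℕ) : pochRatio A B n = affineRatio A B n * pochRatio (A + 1) (B + 1) n := by
  rw [pochRatio, affineRatio, pochRatio, ← Finset.prod_mul_distrib]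
  refine Finset.prod_congr rfl fun i _ => ?_
  have hAi := hA i
  have hBi := hB i
  have hBn := ascPochhammer_pos n (B i) hBi
  have hBn' := ascPochhammer_pos n (B i + 1) (by linarith)
  simp only [Pi.add_apply, Pi.one_apply]
  rw [div_mul_div_comm, div_eq_div_iff (by positivity) (by positivity)]
  linear_combination (B i * (ascPochhammer ℝ n).eval (B i + 1)) * ascPochhammer_eval_mul_add (A i) n
    - (A i * (ascPochhammer ℝ n).eval (A i + 1)) * ascPochhammer_eval_mul_add (B i) n

lemma pochRatio_eq_prod_affineRatio_mul {A B : ι → ℝ} (hA : ∀ i, 0 < A i) (hB : ∀ i, 0 < B i)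
    (N n : ℕ) :
    pochRatio A B n = (∏ k ∈ Finset.range N, affineRatio (A + (k : ι → ℝ)) (B + (k : ι → ℝ)) n) *
      pochRatio (A + (N : ι → ℝ)) (B + (N : ι → ℝ)) n := by
  induction N with
  | zero => simp
  | succ N ih =>
    rw [ih, Finset.prod_range_succ, mul_assoc, Nat.cast_succ, ← add_assoc, ← add_assoc,
      ← pochRatio_eq_affineRatio_mul (A := A + (N : ι → ℝ)) (B := B + (N : ι → ℝ))
        (fun i => add_pos_of_pos_of_nonneg (hA i) N.cast_nonneg)
        fun i => add_pos_of_pos_of_nonneg (hB i) N.cast_nonneg]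

lemma tendsto_ascPochhammer_eval_add_div (a b : ℝ) (n : ℕ) :
    Tendsto (fun N : ℕ => (ascPochhammer ℝ n).eval (a + N) / (ascPochhammer ℝ n).eval (b + N))
      atTop (𝓝 1) := by
  induction n with
  | zero => simp
  | succ n ih =>
    have h : Tendsto (fun N : ℕ => (a + N + n) / (b + N + n : ℝ)) atTop (𝓝 1) := by
      simpa [add_right_comm] using
        tendsto_add_mul_div_add_mul_atTop_nhds (a + n) (b + n) (1 : ℝ) one_ne_zero
    simpa [ascPochhammer_succ_eval, mul_div_mul_comm] using ih.mul h

lemma tendsto_pochRatio_add (A B : ι → ℝ) (n : ℕ) :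
    Tendsto (fun N : ℕ => pochRatio (A + (N : ι → ℝ)) (B + (N : ι → ℝ)) n) atTop (𝓝 1) := by
  simpa [pochRatio] using
    tendsto_finsetProd Finset.univ fun i _ => tendsto_ascPochhammer_eval_add_div (A i) (B i) n

lemma tendsto_prod_affineRatio {A B : ι → ℝ} (hA : ∀ i, 0 < A i) (hB : ∀ i, 0 < B i) :
    Tendsto
      (fun N : ℕ => ∏ k ∈ Finset.range N, affineRatio (A + (k : ι → ℝ)) (B + (k : ι → ℝ))) atTop
      (𝓝 (pochRatio A B)) := by
  refine tendsto_pi_nhds.mpr fun n => ?_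
  have h := (tendsto_const_nhds (x := pochRatio A B n)).div (tendsto_pochRatio_add A B n)
    one_ne_zero
  rw [div_one] at h
  refine h.congr fun N => ?_
  have hpos : 0 < pochRatio (A + (N : ι → ℝ)) (B + (N : ι → ℝ)) n :=
    pochRatio_pos (fun i => add_pos_of_pos_of_nonneg (hA i) N.cast_nonneg)
      (fun i => add_pos_of_pos_of_nonneg (hB i) N.cast_nonneg) n
  rw [Finset.prod_apply, Pi.div_apply, pochRatio_eq_prod_affineRatio_mul hA hB N n,
    mul_div_cancel_right₀ _ hpos.ne']

variable [LinearOrder ι] [LocallyFiniteOrderBot ι] {A B : ι → ℝ}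

theorem pochRatio_mem_hausdorffMoments (hA : ∀ i, 0 < A i) (hB : Monotone B)
    (hsum : ∀ k, ∑ i ∈ Finset.Iic k, A i ≤ ∑ i ∈ Finset.Iic k, B i) :
    pochRatio A B ∈ hausdorffMoments := by
  refine isClosed_hausdorffMoments.mem_of_tendsto
    (tendsto_prod_affineRatio hA (forall_lt_of_sum_Iic_le hB hsum hA))
    (Eventually.of_forall fun N => prod_mem fun k _ => ?_)
  refine affineRatio_mem_hausdorffMoments
    (fun i => add_pos_of_pos_of_nonneg (hA i) k.cast_nonneg) (hB.add_const _) fun m => ?_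
  simpa [Finset.sum_add_distrib] using hsum m

theorem pochRatio_one_sq_lt_pochRatio_two (hA : ∀ i, 0 < A i) (hB : Monotone B)
    (hsum : ∀ k, ∑ i ∈ Finset.Iic k, A i ≤ ∑ i ∈ Finset.Iic k, B i) (hne : A ≠ B) :
    pochRatio A B 1 ^ 2 < pochRatio A B 2 := by
  have hB0 := forall_lt_of_sum_Iic_le hB hsum hA
  have hpos : 0 < pochRatio (A + 1) (B + 1) 1 :=
    pochRatio_pos (fun i => add_pos (hA i) one_pos) (fun i => add_pos (hB0 i) one_pos) 1
  calc pochRatio A B 1 ^ 2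
      = pochRatio A B 1 * (affineRatio A B 1 * pochRatio (A + 1) (B + 1) 1) := by
        rw [sq, ← pochRatio_eq_affineRatio_mul hA hB0]
    _ < pochRatio A B 1 * pochRatio (A + 1) (B + 1) 1 :=
        mul_lt_mul_of_pos_left
          (mul_lt_of_lt_one_left hpos (affineRatio_one_lt_one hA hB hsum hne))
          (pochRatio_pos hA hB0 1)
    _ = pochRatio A B 2 := (pochRatio_succ A B 1).symm

end PochRatio

/-! ### Generalized Stieltjes transforms -/

section StieltjesTransform

lemma hasDerivAt_integral_of_continuousOn {𝕜 X E : Type*} [RCLike 𝕜] [TopologicalSpace X]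
    [CompactSpace X] [MeasurableSpace X] [OpensMeasurableSpace X] [NormedAddCommGroup E]
    [NormedSpace ℝ E] [NormedSpace 𝕜 E] (μ : Measure X) [IsFiniteMeasure μ] {U : Set 𝕜}
    (hU : IsOpen U) {f f' : 𝕜 → X → E} (hf : ∀ z ∈ U, Continuous (f z))
    (hf' : ContinuousOn (Function.uncurry f') (U ×ˢ Set.univ))
    (hderiv : ∀ z ∈ U, ∀ t, HasDerivAt (fun w => f w t) (f' z t) z) {z : 𝕜} (hz : z ∈ U) :
    HasDerivAt (fun w => ∫ t, f w t ∂μ) (∫ t, f' z t ∂μ) z := by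
  obtain ⟨ε, hε, hball⟩ := Metric.nhds_basis_closedBall.mem_iff.mp (hU.mem_nhds hz)
  obtain ⟨M, hM⟩ := ((isCompact_closedBall z ε).prod isCompact_univ).exists_bound_of_continuousOn
    (hf'.mono (Set.prod_mono hball Set.Subset.rfl))
  have hf'z : Continuous (f' z) :=
    hf'.comp_continuous (f := fun t => (z, t)) (by fun_prop) fun t => ⟨hz, trivial⟩
  refine (hasDerivAt_integral_of_dominated_loc_of_deriv_le (bound := fun _ => M)
    (Metric.closedBall_mem_nhds z hε) ?_ (integrable_of_continuous μ (hf z hz))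
    (integrable_of_continuous μ hf'z).aestronglyMeasurable
    (Eventually.of_forall fun t w hw => hM (w, t) ⟨hw, trivial⟩) (integrable_const M)
    (Eventually.of_forall fun t w hw => hderiv w (hball hw) t)).2
  filter_upwards [hU.mem_nhds hz] with w hw
  exact (integrable_of_continuous μ (hf w hw)).aestronglyMeasurable

lemma mem_cutPlane_iff {z : ℂ} : z ∈ cutPlane ↔ 1 - z ∈ Complex.slitPlane := by
  simp only [cutPlane_eq, Set.mem_image]
  exact ⟨by rintro ⟨w, hw, rfl⟩; simpa using hw, fun hz => ⟨1 - z, hz, by ring⟩⟩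

lemma isOpen_cutPlane : IsOpen cutPlane := by
  convert Complex.isOpen_slitPlane.preimage (f := fun z : ℂ => 1 - z) (by fun_prop) using 1
  exact Set.ext fun z => mem_cutPlane_iff

lemma one_sub_mul_mem_slitPlane {z : ℂ} (hz : z ∈ cutPlane) (t : unitInterval) :
    1 - z * (t : ℝ) ∈ Complex.slitPlane := by
  have h := Complex.starConvex_one_slitPlane (mem_cutPlane_iff.mp hz)
    (sub_nonneg.mpr t.2.2) t.2.1 (by ring)
  convert h using 1
  simp only [Complex.real_smul]
  push_cast
  ring

lemma hasSum_ascPochhammer_one_sub_cpow (s : ℂ) {w : ℂ} (hw : ‖w‖ < 1) :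
    HasSum (fun n : ℕ => (ascPochhammer ℂ n).eval s / n.factorial * w ^ n) ((1 - w) ^ (-s)) := by
  have hmem : w ∈ Metric.eball (0 : ℂ) 1 := by
    rw [← ENNReal.ofReal_one, Metric.eball_ofReal]
    simpa using hw
  have h := (Complex.one_div_one_sub_cpow_hasFPowerSeriesOnBall_zero s).hasSum hmem
  rw [zero_add, one_div, ← Complex.cpow_neg] at h
  refine h.congr_fun fun n => ?_
  have hfac : ((n.factorial : ℕ) : ℂ) ≠ 0 := by exact_mod_cast n.factorial_ne_zero
  have hmulti := Ring.factorial_nsmul_multichoose_eq_ascPochhammer s n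
  rw [Polynomial.ascPochhammer_smeval_eq_eval, nsmul_eq_mul, Ring.multichoose_eq] at hmulti
  simp [FormalMultilinearSeries.ofScalars, ← hmulti, hfac]

/-- The generalized Stieltjes transform of order `s` of a measure `μ` on `[0, 1]`, holomorphic off
the cut `[1, ∞)`. The branch of the power is the principal one. -/
noncomputable def stieltjesTransform (s : ℂ) (μ : Measure unitInterval) (z : ℂ) : ℂ :=
  ∫ t, (1 - z * (t : ℝ)) ^ (-s) ∂μ

lemma stieltjesTransform_neg_ofReal (σ : ℝ) (μ : Measure unitInterval) {x : ℝ} (hx : 0 ≤ x) :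
    stieltjesTransform σ μ (-x) = ((∫ t, (1 + x * t) ^ (-σ) ∂μ : ℝ) : ℂ) := by
  rw [stieltjesTransform, ← integral_complex_ofReal]
  refine integral_congr_ae (Eventually.of_forall fun t => ?_)
  have hpos : 0 ≤ 1 + x * (t : ℝ) := by have := t.2.1; positivity
  simp [Complex.ofReal_cpow hpos]

variable (s : ℂ) (μ : Measure unitInterval) [IsFiniteMeasure μ]

lemma analyticOnNhd_stieltjesTransform : AnalyticOnNhd ℂ (stieltjesTransform s μ) cutPlane := by
  have hcpow (r : ℂ) : ContinuousOn
      (fun p : ℂ × unitInterval => (1 - p.1 * ((p.2 : ℝ) : ℂ)) ^ r) (cutPlane ×ˢ Set.univ) :=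
    ContinuousOn.cpow (by fun_prop) continuousOn_const
      fun p hp => one_sub_mul_mem_slitPlane hp.1 p.2
  refine DifferentiableOn.analyticOnNhd (fun z hz => ?_) isOpen_cutPlane
  refine (hasDerivAt_integral_of_continuousOn μ isOpen_cutPlane
    (f' := fun z t => -s * (1 - z * (t : ℝ)) ^ (-s - 1) * -((t : ℝ) : ℂ)) (fun w hw => ?_)
    ?_ (fun w hw t => ?_) hz).differentiableAt.differentiableWithinAt
  · exact (hcpow (-s)).comp_continuous (f := fun t => (w, t)) (by fun_prop)
      fun t => ⟨hw, trivial⟩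
  · exact (continuousOn_const.mul (hcpow (-s - 1))).mul (by fun_prop)
  · have hlin : HasDerivAt (fun w : ℂ => 1 - w * ((t : ℝ) : ℂ)) (-((t : ℝ) : ℂ)) w := by
      simpa using ((hasDerivAt_id w).mul_const ((t : ℝ) : ℂ)).const_sub 1
    exact hlin.cpow_const (one_sub_mul_mem_slitPlane hw t)

lemma hasSum_stieltjesTransform {z : ℂ} (hz : ‖z‖ < 1) :
    HasSum (fun n : ℕ => (ascPochhammer ℂ n).eval s / n.factorial * momentSeq μ n * z ^ n)
      (stieltjesTransform s μ z) := by
  set F : ℕ → unitInterval → ℂ := fun n t =>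
    (ascPochhammer ℂ n).eval s / n.factorial * (z * (t : ℝ)) ^ n with hF
  have hint (n : ℕ) : Integrable (F n) μ := integrable_of_continuous μ (by fun_prop)
  have hzt (t : unitInterval) : ‖z * ((t : ℝ) : ℂ)‖ ≤ ‖z‖ := by
    rw [norm_mul, Complex.norm_real, Real.norm_of_nonneg t.2.1]
    exact mul_le_of_le_one_right (norm_nonneg z) t.2.2
  have hbound (n : ℕ) (t : unitInterval) :
      ‖F n t‖ ≤ ‖(ascPochhammer ℂ n).eval s / n.factorial * z ^ n‖ := by
    simp only [hF, norm_mul _ (_ ^ n), norm_pow]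
    gcongr
    exact hzt t
  have hsum : Summable fun n => ∫ t, ‖F n t‖ ∂μ :=
    Summable.of_nonneg_of_le (fun n => integral_nonneg fun t => norm_nonneg _)
      (fun n => (integral_mono (hint n).norm (integrable_const _) (hbound n)).trans_eq
        (integral_const _))
      ((hasSum_ascPochhammer_one_sub_cpow s hz).summable.norm.const_smul _)
  convert! hasSum_integral_of_summable_integral_norm hint hsum using 1
  · funext n
    simp only [hF, mul_pow, ← mul_assoc, integral_const_mul, momentSeq, ← integral_complex_ofReal]
    push_cast
    ring
  · exact integral_congr_ae (Eventually.of_forall fun t =>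
      (hasSum_ascPochhammer_one_sub_cpow s ((hzt t).trans_lt hz)).tsum_eq.symm)

end StieltjesTransform

/-! ### Size-biased measures and Jensen's inequality -/

section SizeBiased

/-- The size-biased version of a measure `ν` on `[0, 1]`: the density `t` with respect to `ν`,
normalized to total mass `1`. It is the zero measure when the mean of `ν` is `0`. -/
noncomputable def sizeBiased (ν : Measure unitInterval) : Measure unitInterval :=
  ν.withDensity fun t => ENNReal.ofReal (t / momentSeq ν 1)

instance isFiniteMeasure_sizeBiased (ν : Measure unitInterval) [IsFiniteMeasure ν] :
    IsFiniteMeasure (sizeBiased ν) :=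
  isFiniteMeasure_withDensity_ofReal
    (integrable_of_continuous ν (f := fun t : unitInterval => (t : ℝ) / momentSeq ν 1)
      (by fun_prop)).2

lemma integral_sizeBiased (ν : Measure unitInterval) (f : unitInterval → ℝ) :
    ∫ t, f t ∂sizeBiased ν = (∫ t, t * f t ∂ν) / momentSeq ν 1 := by
  have hmean : 0 ≤ momentSeq ν 1 := integral_nonneg fun t => by simpa using t.2.1
  rw [sizeBiased, integral_withDensity_eq_integral_toReal_smul (by fun_prop)
    (Eventually.of_forall fun _ => ENNReal.ofReal_lt_top), ← integral_div]
  refine integral_congr_ae (Eventually.of_forall fun t => ?_)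
  simp only [smul_eq_mul, ENNReal.toReal_ofReal (div_nonneg t.2.1 hmean)]
  ring

lemma momentSeq_sizeBiased (ν : Measure unitInterval) (n : ℕ) :
    momentSeq (sizeBiased ν) n = momentSeq ν (n + 1) / momentSeq ν 1 := by
  rw [momentSeq, integral_sizeBiased]
  simp only [← pow_succ', momentSeq]

lemma momentSeq_antitone (ν : Measure unitInterval) [IsFiniteMeasure ν] :
    Antitone (momentSeq ν) := fun _ _ hmn =>
  integral_mono (integrable_of_continuous ν (by fun_prop))
    (integrable_of_continuous ν (by fun_prop)) fun t => pow_le_pow_of_le_one t.2.1 t.2.2 hmn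

lemma hasDerivAt_one_add_mul_rpow (p : ℝ) {x t : ℝ} (hxt : 1 + x * t ≠ 0) :
    HasDerivAt (fun t : ℝ => (1 + x * t) ^ p) (x * p * (1 + x * t) ^ (p - 1)) t := by
  have hlin : HasDerivAt (fun t : ℝ => 1 + x * t) x t := by
    simpa using ((hasDerivAt_id t).const_mul x).const_add 1
  exact hlin.rpow_const (.inl hxt)

lemma hasDerivAt_mul_one_add_rpow (σ : ℝ) {x t : ℝ} (hxt : 1 + x * t ≠ 0) :
    HasDerivAt (fun t : ℝ => t * (1 + x * t) ^ (-σ))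
      ((1 - σ) * (1 + x * t) ^ (-σ) + σ * (1 + x * t) ^ (-σ - 1)) t := by
  refine ((hasDerivAt_id t).mul (hasDerivAt_one_add_mul_rpow (-σ) hxt)).congr_deriv ?_
  rw [Real.rpow_sub_one hxt]
  simp only [id]
  field_simp
  ring

lemma hasDerivAt_deriv_mul_one_add_rpow (σ : ℝ) {x t : ℝ} (hxt : 1 + x * t ≠ 0) :
    HasDerivAt (fun t : ℝ => (1 - σ) * (1 + x * t) ^ (-σ) + σ * (1 + x * t) ^ (-σ - 1))
      (-(σ * x * (2 - (σ - 1) * x * t) * (1 + x * t) ^ (-σ - 1 - 1))) t := by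
  refine (((hasDerivAt_one_add_mul_rpow (-σ) hxt).const_mul (1 - σ)).add
    ((hasDerivAt_one_add_mul_rpow (-σ - 1) hxt).const_mul σ)).congr_deriv ?_
  rw [Real.rpow_sub_one hxt (-σ - 1)]
  field_simp
  ring

/-- The condition `(σ - 1) * x ≤ 2` says that the factor `2 - (σ - 1) * x * t` of the second
derivative does not change sign on `[0, 1]`. -/
lemma strictConcaveOn_mul_one_add_rpow {σ x : ℝ} (hσ : 0 < σ) (hx : 0 < x)
    (hσx : (σ - 1) * x ≤ 2) :
    StrictConcaveOn ℝ (Set.Icc 0 1) fun t : ℝ => t * (1 + x * t) ^ (-σ) := by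
  have hpos {t : ℝ} (ht : t ∈ Set.Icc (0 : ℝ) 1) : 0 < 1 + x * t := by
    have := ht.1; positivity
  have hanti : StrictAntiOn (fun t : ℝ => (1 - σ) * (1 + x * t) ^ (-σ) +
      σ * (1 + x * t) ^ (-σ - 1)) (Set.Icc 0 1) := by
    refine strictAntiOn_of_deriv_neg (convex_Icc 0 1) (fun t ht =>
      (hasDerivAt_deriv_mul_one_add_rpow σ (hpos ht).ne').continuousAt.continuousWithinAt)
      fun t ht => ?_
    have hbase := hpos (interior_subset ht)
    rw [(hasDerivAt_deriv_mul_one_add_rpow σ hbase.ne').deriv, neg_lt_zero]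
    rw [interior_Icc] at ht
    have : 0 < 2 - (σ - 1) * x * t := by nlinarith [ht.1, ht.2]
    positivity
  refine StrictAntiOn.strictConcaveOn_of_deriv (convex_Icc 0 1) (fun t ht =>
    (hasDerivAt_mul_one_add_rpow σ (hpos ht).ne').continuousAt.continuousWithinAt) ?_
  exact (hanti.mono interior_subset).congr fun t ht =>
    (hasDerivAt_mul_one_add_rpow σ (hpos (interior_subset ht)).ne').deriv.symm

lemma integral_mul_one_add_rpow_lt (ν : Measure unitInterval) [IsProbabilityMeasure ν]
    (hν : momentSeq ν 1 ^ 2 ≠ momentSeq ν 2) {σ x : ℝ} (hσ : 0 < σ) (hx : 0 < x)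
    (hσx : (σ - 1) * x ≤ 2) :
    ∫ t, (t : ℝ) * (1 + x * t) ^ (-σ) ∂ν <
      momentSeq ν 1 * (1 + x * momentSeq ν 1) ^ (-σ) := by
  have hcont : ContinuousOn (fun t : ℝ => t * (1 + x * t) ^ (-σ)) (Set.Icc 0 1) :=
    continuousOn_id.mul (ContinuousOn.rpow_const (by fun_prop) fun t ht =>
      .inl (by have := ht.1; positivity))
  have hmean : ⨍ t : unitInterval, (t : ℝ) ∂ν = momentSeq ν 1 := by
    simp [average_eq_integral, momentSeq]
  rcases (strictConcaveOn_mul_one_add_rpow hσ hx hσx).ae_eq_const_or_lt_map_average (μ := ν)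
    (f := fun t : unitInterval => (t : ℝ)) hcont isClosed_Icc (Eventually.of_forall Subtype.prop)
    (integrable_of_continuous ν continuous_subtype_val)
    (integrable_of_continuous ν
      (hcont.comp_continuous continuous_subtype_val Subtype.prop)) with hconst | hlt
  · refine absurd ?_ hν
    rw [hmean] at hconst
    calc momentSeq ν 1 ^ 2 = ∫ _ : unitInterval, momentSeq ν 1 ^ 2 ∂ν := by simp
      _ = momentSeq ν 2 :=
        integral_congr_ae (hconst.symm.mono fun t ht => congrArg (· ^ 2) ht)
  · simpa only [hmean, average_eq_integral] using hlt

lemma integral_sizeBiased_one_add_rpow_lt (ν : Measure unitInterval) [IsProbabilityMeasure ν]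
    (hν : momentSeq ν 1 ^ 2 < momentSeq ν 2) {σ x : ℝ} (hσ : 0 < σ) (hx : 0 < x)
    (hσx : (σ - 1) * x ≤ 2) :
    ∫ t, (1 + x * t) ^ (-σ) ∂sizeBiased ν < (1 + x * momentSeq ν 1) ^ (-σ) := by
  have hmean : 0 < momentSeq ν 1 :=
    (sq_nonneg _).trans_lt (hν.trans_le (momentSeq_antitone ν one_le_two))
  rw [integral_sizeBiased, div_lt_iff₀' hmean]
  exact integral_mul_one_add_rpow_lt ν hν.ne hσ hx hσx

end SizeBiased

/-! ### The hypergeometric function -/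

section Hypergeometric

variable {q : ℕ}

lemma ascPochhammer_eval_ofReal (n : ℕ) (a : ℝ) :
    (ascPochhammer ℂ n).eval (a : ℂ) = (((ascPochhammer ℝ n).eval a : ℝ) : ℂ) :=
  (ascPochhammer_eval₂ Complex.ofRealHom n _).trans (Polynomial.eval₂_at_apply _ _)

lemma hypTerm_ofReal (s : ℂ) (A B : Fin q → ℝ) (z : ℂ) (n : ℕ) :
    hypTerm s (fun i => (A i : ℂ)) (fun i => (B i : ℂ)) z n =
      (ascPochhammer ℂ n).eval s / n.factorial * pochRatio A B n * z ^ n := by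
  simp only [hypTerm, pochRatio, ascPochhammer_eval_ofReal, Finset.prod_div_distrib]
  push_cast
  rw [div_mul_div_comm, mul_comm (n.factorial : ℂ)]

lemma isHypContinuation_stieltjesTransform (s : ℂ) {A B : Fin q → ℝ} (μ : Measure unitInterval)
    [IsFiniteMeasure μ] (hμ : momentSeq μ = pochRatio A B) :
    IsHypContinuation s (fun i => (A i : ℂ)) (fun i => (B i : ℂ)) (stieltjesTransform s μ) where
  analytic := analyticOnNhd_stieltjesTransform s μ
  hasSum z hz :=
    (hasSum_stieltjesTransform s μ hz).congr_fun fun n => by rw [hypTerm_ofReal, hμ]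

lemma IsHypContinuation.isHypContinuation_genHyp {σ : ℂ} {A B : Fin q → ℂ} {F : ℂ → ℂ}
    (hF : IsHypContinuation σ A B F) : IsHypContinuation σ A B (genHyp σ A B) := by
  have h : ∃ F, IsHypContinuation σ A B F := ⟨F, hF⟩
  rw [genHyp, dif_pos h]
  exact h.choose_spec

lemma momentSeq_sizeBiased_eq_pochRatio {A B : Fin q → ℝ} {ν : Measure unitInterval}
    (hν : momentSeq ν = pochRatio (A - 1) (B - 1)) (h1 : pochRatio (A - 1) (B - 1) 1 ≠ 0) :
    momentSeq (sizeBiased ν) = pochRatio A B := by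
  funext n
  rw [momentSeq_sizeBiased, hν, pochRatio_succ, sub_add_cancel, sub_add_cancel,
    mul_div_cancel_left₀ _ h1]

theorem mainTheorem6_general {A B : Fin q → ℝ} (hA : ∀ i, 1 < A i) (hB : Monotone B)
    (hsum : ∀ k, ∑ i ∈ Finset.Iic k, A i ≤ ∑ i ∈ Finset.Iic k, B i) (hne : A ≠ B)
    {σ : ℝ} (hσ : 0 < σ) :
    IsHypContinuation (σ : ℂ) (fun i => (A i : ℂ)) (fun i => (B i : ℂ))
        (genHyp (σ : ℂ) (fun i => (A i : ℂ)) (fun i => (B i : ℂ))) ∧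
      ∀ x : ℝ, 0 < x → (σ - 1) * x ≤ 2 →
        (genHyp (σ : ℂ) (fun i => (A i : ℂ)) (fun i => (B i : ℂ)) (-(x : ℂ))).im = 0 ∧
        (genHyp (σ : ℂ) (fun i => (A i : ℂ)) (fun i => (B i : ℂ)) (-(x : ℂ))).re <
          1 / (1 + x * ∏ i, ((A i - 1) / (B i - 1))) ^ σ := by
  have hA' : ∀ i, 0 < (A - 1) i := fun i => sub_pos.mpr (hA i)
  have hB' : Monotone (B - 1) := fun i j hij => sub_le_sub_right (hB hij) 1
  have hsum' : ∀ k, ∑ i ∈ Finset.Iic k, (A - 1) i ≤ ∑ i ∈ Finset.Iic k, (B - 1) i := by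
    simpa using hsum
  have hc : pochRatio (A - 1) (B - 1) 1 = ∏ i, (A i - 1) / (B i - 1) := pochRatio_one _ _
  have hpos := hc ▸ pochRatio_pos hA' (forall_lt_of_sum_Iic_le hB' hsum' hA') 1
  have hvar := pochRatio_one_sq_lt_pochRatio_two hA' hB' hsum' (sub_left_injective.ne hne)
  obtain ⟨ν, _, hν⟩ := exists_momentSeq_eq (pochRatio_mem_hausdorffMoments hA' hB' hsum')
  have hF := isHypContinuation_stieltjesTransform σ (sizeBiased ν)
    (momentSeq_sizeBiased_eq_pochRatio hν (hc ▸ hpos.ne'))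
  refine ⟨hF.isHypContinuation_genHyp, fun x hx hσx => ?_⟩
  have hxmem : -(x : ℂ) ∈ cutPlane := fun _ => by simpa using (neg_lt_zero.mpr hx).trans one_pos
  rw [hF.genHyp_eqOn hxmem, stieltjesTransform_neg_ofReal _ _ hx.le]
  refine ⟨Complex.ofReal_im _, ?_⟩
  rw [Complex.ofReal_re, one_div, ← Real.rpow_neg (by positivity), ← hc, ← hν]
  exact integral_sizeBiased_one_add_rpow_lt ν (hν ▸ hvar) hσ hx hσx

end Hypergeometric

theorem mainTheorem6 (q : ℕ) (hq : 0 < q) (A B : Fin q → ℝ)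
    (hBA : WeaklySupermajorizedBy B A) (hne : A ≠ B)
    (hA1 : 1 < A ⟨0, hq⟩) (hB1 : 1 < B ⟨0, hq⟩)
    (σ : ℝ) (hσ0 : 0 < σ) (hσ1 : σ ≤ 1) :
    IsHypContinuation (σ : ℂ) (fun i => (A i : ℂ)) (fun i => (B i : ℂ))
        (genHyp (σ : ℂ) (fun i => (A i : ℂ)) (fun i => (B i : ℂ))) ∧
      ∀ x : ℝ, 0 < x →
        (genHyp (σ : ℂ) (fun i => (A i : ℂ)) (fun i => (B i : ℂ)) (-(x : ℂ))).im = 0 ∧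
        (genHyp (σ : ℂ) (fun i => (A i : ℂ)) (fun i => (B i : ℂ)) (-(x : ℂ))).re <
          1 / (1 + x * ∏ i, ((A i - 1) / (B i - 1))) ^ σ := by
  have hA (i : Fin q) : 1 < A i := hA1.trans_le (hBA.mono_A (Nat.zero_le _))
  exact (mainTheorem6_general hA hBA.mono_B hBA.sum_le hne hσ0).imp_right
    fun h x hx => h x hx (by nlinarith)
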